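/- **Setting.** Let $x\in\{-1,+1\}^4$ and consider the binary pairwise models on 4 fully connected nodes with energy $E_\theta(x)=-\sum_i\theta_i x_i-\sum_{i<j}\theta_{ij}x_ix_j$, where the parameters $\theta$ are arbitrary real numbers. The factors $\alpha$ are the 4 single nodes and the 6 pairs. Write $\psi_\alpha(x_\alpha)=e^{\theta_i x_i}$ if $\alpha=\{i\}$ and $\psi_\alpha(x_\alpha)=e^{\theta_{ij}x_ix_j}$ if $\alpha=\{i,j\}$. Belief propagation (BP) acts on strictly positive messages, normalized to sum to one, by $$m_{i\to\alpha}(x_i)\propto\prod_{\beta\ni i,\ \beta\ne\alpha}m_{\beta\to i}(x_i),\qquad m_{\alpha\to i}(x_i)\propto\sum_{x_\alpha\setminus x_i}\psi_\alpha(x_\alpha)\prod_{j\in\alpha\setminus i}m_{j\to\alpha}(x_j).$$ All messages are updated synchronously, possibly with damping: the new factor-to-node messages are $a\cdot(\text{old})+(1-a)\cdot(\text{undamped update})$ for a fixed $a\in[0,1)$. The beliefs are $b_i(x_i)\propto\prod_{\alpha\ni i}m_{\alpha\to i}(x_i)$ and $b_\alpha(x_\alpha)\propto\psi_\alpha(x_\alpha)\prod_{i\in\alpha}m_{i\to\alpha}(x_i)$,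 normalized to sum to one. Call marginals $p=(p_i,p_\alpha)$ *unbelievable* if, for every choice of parameters $\theta$ and of the damping $a$, no BP fixed point with beliefs $p$ is Lyapunov stable, and none is locally attracting (i.e. all BP runs started close enough to it converge to it). The Bethe free energy of pseudomarginals $q=(q_i,q_\alpha)$ is $$F^\beta_\theta[q]=-\sum_{\alpha}\sum_{x_\alpha}q_\alpha(x_\alpha)\log\psi_\alpha(x_\alpha)+\sum_\alpha\sum_{x_\alpha}q_\alpha(x_\alpha)\log q_\alpha(x_\alpha)+\sum_i(1-d_i)\sum_{x_i}q_i(x_i)\log q_i(x_i),$$ where $d_i$ is the number of factors containing $i$. The Bethe Hessian is the Hessian of $F^\beta_\theta$ on locally consistent, normalized $q$, in the coordinates $q_i(+1)$, $q_{ij}(+1,+1)$. **Theorem.** Unbelievable marginals exist: there are probability distributions in this family whose true marginals are unbelievable. More precisely, for $J\in\mathbb R$ let $p$ be the true marginals of the distribution $P(x)\propto e^{J\sum_{i<j}x_ix_j}$ on $\{-1,+1\}^4$. 1. $p_i(x_i)=\tfrac12$, and $p_{ij}(x_i,x_j)=\rho$ if $x_i=x_j$, $p_{ij}(x_i,x_j)=\tfrac12-\rho$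 if $x_i\neq x_j$, where $\rho=\rho(J)=\bigl(2+4/(1+e^{2J}-e^{4J}+e^{6J})\bigr)^{-1}$. 2. There is a threshold $J_c\in(0.3155,0.316)$ (so $J_c\approx 0.316$) such that $\rho(J)>\tfrac38$ if and only if $J>J_c$. 3. Whenever $\rho>\tfrac38$: for every $\theta$, $F^\beta_\theta$ is twice continuously differentiable at $p$ in these coordinates and the Bethe Hessian at $p$ has a negative eigenvalue; for every $\theta$, $p$ is not a local minimum of $F^\beta_\theta$ on the set of pseudomarginals (nonnegative, normalized, locally consistent $q$); and $p$ is unbelievable. -/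

import Mathlib

open Filter Topology

noncomputable section

/-- A discrete graphical model in exponential family form (a factor graph with sufficient
statistics).  The variables are indexed by `V` and take values in `S`; the factors are indexed by
`A`.  The factor `α` acts on the `arity α` distinct variables `var α 0, var α 1, …`, and has a
vector `stat α` of `dim α` sufficient statistics. -/
structure GraphicalModel (V A S : Type) where
  arity : A → ℕ
  var : (α : A) → Fin (arity α) → V
  var_injective : ∀ α, Function.Injective (var α)
  dim : A → ℕ
  stat : (α : A) → (Fin (arity α) → S) → Fin (dim α) → ℝ

namespace GraphicalModel

variable {V A S : Type} [Fintype V] [Fintype A] [Fintype S]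
  [DecidableEq V] [DecidableEq A] [DecidableEq S]

/-- Natural parameters: one real vector for each factor. -/
abbrev Params (M : GraphicalModel V A S) : Type := (α : A) → Fin (M.dim α) → ℝ

/-- Collections of real numbers `q_i(x_i)` (first component) and `q_α(x_α)` (second component). -/
abbrev Pseudo (M : GraphicalModel V A S) : Type :=
  (V → S → ℝ) × ((α : A) → (Fin (M.arity α) → S) → ℝ)

/-- Factor-to-node messages: `m α k` is the message from the factor `α` to its `k`-th variable.
The same type holds the node-to-factor messages, `n α k` being the message from the `k`-th
variable of `α` to `α`. -/
abbrev Messages (M : GraphicalModel V A S) : Type := (α : A) → Fin (M.arity α) → S → ℝ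

/-! ### The Boltzmann distribution and its marginals -/

/-- The energy `E(x) = - ∑ α, θ_α · φ_α(x_α)`. -/
def energy (M : GraphicalModel V A S) (θ : M.Params) (x : V → S) : ℝ :=
  -∑ α, ∑ k, θ α k * M.stat α (fun l => x (M.var α l)) k

/-- The Boltzmann distribution `exp (-E(x)) / Z`. -/
def boltzmann (M : GraphicalModel V A S) (θ : M.Params) (x : V → S) : ℝ :=
  Real.exp (-M.energy θ x) / ∑ z, Real.exp (-M.energy θ z)

/-- The true node and factor marginals of the Boltzmann distribution. -/
def marginals (M : GraphicalModel V A S) (θ : M.Params) : M.Pseudo :=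
  (fun i s => ∑ x with x i = s, M.boltzmann θ x,
   fun α y => ∑ x with (fun l => x (M.var α l)) = y, M.boltzmann θ x)

/-! ### Sum-product belief propagation -/

/-- Rescale a function on a finite type so that its values sum to one. -/
def normalized {T : Type} [Fintype T] (f : T → ℝ) : T → ℝ := fun t => f t / ∑ u, f u

/-- The factor `exp (θ_α · φ_α(x_α))`. -/
def potential (M : GraphicalModel V A S) (θ : M.Params) (α : A) (y : Fin (M.arity α) → S) : ℝ :=
  Real.exp (∑ k, θ α k * M.stat α y k)

/-- `m_{i→α}(x_i) ∝ ∏ m_{β→i}(x_i)`, over the factors `β ≠ α` that contain the node `i`. -/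
def nodeToFactor (M : GraphicalModel V A S) (m : M.Messages) : M.Messages := fun α k =>
  normalized fun s => ∏ β with β ≠ α, ∏ l with M.var β l = M.var α k, m β l s

/-- `m_{α→i}(x_i) ∝ ∑ exp (θ_α · φ_α(x_α)) ∏ m_{j→α}(x_j)`, the sum over `x_α` with the value
`x_i` given, the product over the variables `j ≠ i` of `α`. -/
def factorToNode (M : GraphicalModel V A S) (θ : M.Params) (n : M.Messages) : M.Messages :=
  fun α k => normalized fun s =>
    ∑ y with y k = s, M.potential θ α y * ∏ j with j ≠ k, n α j (y j)

/-- One synchronous round of belief propagation with damping `a`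
(`a = 0` is the undamped algorithm). -/
def bpStep (M : GraphicalModel V A S) (θ : M.Params) (a : ℝ) (m : M.Messages) : M.Messages :=
  a • m + (1 - a) • M.factorToNode θ (M.nodeToFactor m)

/-- The space of strictly positive normalized messages. -/
def messageSpace (M : GraphicalModel V A S) : Set M.Messages :=
  {m | ∀ α k, (∀ s, 0 < m α k s) ∧ ∑ s, m α k s = 1}

/-- The node and factor beliefs that belong to the factor-to-node messages `m`. -/
def beliefs (M : GraphicalModel V A S) (θ : M.Params) (m : M.Messages) : M.Pseudo :=
  (fun i => normalized fun s => ∏ β, ∏ l with M.var β l = i, m β l s,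
   fun α => normalized fun y => M.potential θ α y * ∏ k, M.nodeToFactor m α k (y k))

/-- Lyapunov stability of `m` under the belief propagation dynamics: runs that start close enough
to `m` stay close to `m`. -/
def IsStable (M : GraphicalModel V A S) (θ : M.Params) (a : ℝ) (m : M.Messages) : Prop :=
  ∀ U ∈ 𝓝 m, ∃ W ∈ 𝓝 m, ∀ m₀ ∈ W ∩ M.messageSpace, ∀ t : ℕ, (M.bpStep θ a)^[t] m₀ ∈ U

/-- Local attractivity of `m`: runs that start close enough to `m` converge to `m`. -/
def IsAttracting (M : GraphicalModel V A S) (θ : M.Params) (a : ℝ) (m : M.Messages) : Prop :=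
  ∃ W ∈ 𝓝 m, ∀ m₀ ∈ W ∩ M.messageSpace,
    Tendsto (fun t : ℕ => (M.bpStep θ a)^[t] m₀) atTop (𝓝 m)

/-- The marginals `p` are unbelievable: whatever the parameters `θ` (and whatever the damping),
no fixed point of belief propagation whose beliefs are `p` is stable or attracting. -/
def IsUnbelievable (M : GraphicalModel V A S) (p : M.Pseudo) : Prop :=
  ∀ (θ : M.Params) (a : ℝ), 0 ≤ a → a < 1 →
    ∀ m ∈ M.messageSpace, M.bpStep θ a m = m → M.beliefs θ m = p →
      ¬ M.IsStable θ a m ∧ ¬ M.IsAttracting θ a m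

/-! ### The Bethe free energy -/

/-- The set of pseudomarginals: positivity and local consistency. -/
def pseudomarginals (M : GraphicalModel V A S) : Set M.Pseudo :=
  {q | (∀ α y, 0 ≤ q.2 α y ∧ q.2 α y ≤ 1) ∧
       (∀ α k s, ∑ y with y k = s, q.2 α y = q.1 (M.var α k) s) ∧
       (∀ i s, 0 ≤ q.1 i s ∧ q.1 i s ≤ 1) ∧ (∀ i, ∑ s, q.1 i s = 1)}

/-- The number of factors that contain the node `i`. -/
def degree (M : GraphicalModel V A S) (i : V) : ℕ :=
  (Finset.univ.filter fun α : A => ∃ l, M.var α l = i).card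

/-- The Bethe entropy `∑ α, S_α + ∑ i, (1 - d_i) S_i` (`Real.negMulLog x = - x log x`). -/
def betheEntropy (M : GraphicalModel V A S) (q : M.Pseudo) : ℝ :=
  ∑ α, ∑ y, Real.negMulLog (q.2 α y)
    + ∑ i, (1 - (M.degree i : ℝ)) * ∑ s, Real.negMulLog (q.1 i s)

/-- The average energy `- ∑ α, θ_α · ∑ φ_α(x_α) q_α(x_α)`. -/
def averageEnergy (M : GraphicalModel V A S) (θ : M.Params) (q : M.Pseudo) : ℝ :=
  -∑ α, ∑ k, θ α k * ∑ y, M.stat α y k * q.2 α y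

/-- The Bethe free energy. -/
def betheFreeEnergy (M : GraphicalModel V A S) (θ : M.Params) (q : M.Pseudo) : ℝ :=
  M.averageEnergy θ q - M.betheEntropy q

end GraphicalModel

/-- The matrix of second partial derivatives of `f` at `η`. -/
def hessianMatrix {ι : Type} [Fintype ι] [DecidableEq ι] (f : (ι → ℝ) → ℝ) (η : ι → ℝ) :
    Matrix ι ι ℝ :=
  Matrix.of fun a b => fderiv ℝ (fun ζ => fderiv ℝ f ζ (Pi.single b 1)) η (Pi.single a 1)

/-! ### The fully connected binary pairwise model -/

/-- The two spin values: `true` is `+1` and `false` is `-1`. -/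
def spin (b : Bool) : ℝ := if b then 1 else -1

/-- The factors of the fully connected pairwise model on `n` nodes: one for each node and one for
each unordered pair of distinct nodes (written with its smaller element first). -/
abbrev IsingFactor (n : ℕ) : Type := Fin n ⊕ {e : Fin n × Fin n // e.1 < e.2}

/-- The number of nodes in a factor. -/
abbrev isingArity {n : ℕ} : IsingFactor n → ℕ
  | .inl _ => 1
  | .inr _ => 2

/-- The nodes of a factor. -/
abbrev isingVar {n : ℕ} : (α : IsingFactor n) → Fin (isingArity α) → Fin n
  | .inl i => ![i]
  | .inr e => ![e.1.1, e.1.2]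

theorem isingVar_injective {n : ℕ} (α : IsingFactor n) : Function.Injective (isingVar α) := by
  have key : ∀ i j : Fin n, i ≠ j → Function.Injective ![i, j] := by
    intro i j h k l hkl
    fin_cases k <;> fin_cases l <;> simp_all [eq_comm]
  rcases α with i | ⟨⟨i, j⟩, h⟩
  · exact fun k l _ => Subsingleton.elim (α := Fin 1) k l
  · exact key i j (ne_of_lt h)

/-- The fully connected binary pairwise (Ising) model, with sufficient statistics `x_i` for each
node and `x_i x_j` for each pair of nodes. -/
abbrev isingModel (n : ℕ) : GraphicalModel (Fin n) (IsingFactor n) Bool where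
  arity := isingArity
  var := isingVar
  var_injective := isingVar_injective
  dim := fun _ => 1
  stat := fun _ y _ => ∏ l, spin (y l)

/-- The parameters with no fields and the same coupling `J` for every pair, that is, with
energy `- J ∑ x_i x_j`. -/
def isingCoupling (n : ℕ) (J : ℝ) : (isingModel n).Params
  | .inl _ => fun _ => 0
  | .inr _ => fun _ => J

/-- The affine map that recovers all pseudomarginals of the Ising model from the minimal
coordinates `η_i = q_i(+1)` and `η_ij = q_ij(+1, +1)`. -/
def isingPseudo (n : ℕ) (η : IsingFactor n → ℝ) : (isingModel n).Pseudo :=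
  (fun i s => if s then η (.inl i) else 1 - η (.inl i),
   fun α => match α with
    | .inl i => fun y : Fin 1 → Bool => if y 0 then η (.inl i) else 1 - η (.inl i)
    | .inr e => fun y : Fin 2 → Bool =>
        match y 0, y 1 with
        | true, true => η (.inr e)
        | true, false => η (.inl e.1.1) - η (.inr e)
        | false, true => η (.inl e.1.2) - η (.inr e)
        | false, false => 1 - η (.inl e.1.1) - η (.inl e.1.2) + η (.inr e))

/-- The minimal coordinates `q_i(+1)` and `q_ij(+1, +1)` of pseudomarginals. -/
def isingCoords (n : ℕ) (q : (isingModel n).Pseudo) : IsingFactor n → ℝ :=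
  fun α => q.2 α fun _ => true

/-- The Bethe free energy of the Ising model as a function of the minimal coordinates. -/
def isingBethe (n : ℕ) (θ : (isingModel n).Params) (η : IsingFactor n → ℝ) : ℝ :=
  (isingModel n).betheFreeEnergy θ (isingPseudo n η)

/-- The true marginals of the four-node model with energy `- J ∑ x_i x_j`. -/
def fourNodeMarginals (J : ℝ) : (isingModel 4).Pseudo :=
  (isingModel 4).marginals (isingCoupling 4 J)

/-- The number `ρ`, as a function of the coupling `J`. -/
def rho (J : ℝ) : ℝ :=
  (2 + 4 / (1 + Real.exp (2 * J) - Real.exp (4 * J) + Real.exp (6 * J)))⁻¹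

end

/-!
Two explicit computations carry the theorem, both about the direction in which all four nodes are
biased in the same way.

*Curvature.* In the coordinates `q_i(+1)`, `q_ij(+1, +1)`, raise all ten coordinates at the same
rate, starting from the true marginals. The parameters enter the Bethe free energy only through an
affine function (`isingBethe_line`), and the entropy terms give the second derivative
`12 / ρ - 32` at the start (`deriv_deriv_isingBethe_line`), which is negative exactly when
`ρ > 3/8`. A direction of negative curvature yields a negative eigenvalue of the Hessian matrix by
the spectral theorem (`exists_neg_eigenvalue_hessianMatrix`), and it excludes a local minimum
because the line stays in the set of pseudomarginals for a short time.

*Instability.* The true marginals are invariant under a global spin flip. This determines every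
belief propagation fixed point that has them as beliefs (`fixedPoint_of_beliefs_eq`): the fields
vanish, each coupling is `tanh⁻¹ t` with `t = 4ρ - 1`, and all messages are uniform. Messages with
the same bias `u` on all pairs form an invariant line through that fixed point, on which the damped
algorithm is the map `u ↦ a u + (1 - a) 2 t u / (1 + u²)` (`bpStep_biasedMessages`): a node passes
to a pair the combination of the biases `u` from its two other pairs. The derivative of this map at
`0` is `a + (1 - a) 2 t`, which exceeds `1` exactly when `ρ > 3/8`, so a small positive bias grows
until it leaves a fixed neighbourhood of `0`, and does so again after every return
(`exists_not_eventually_bias_lt`). Hence the fixed point is neither stable nor attracting; no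
spectral theory of the full dynamics is needed.
-/

/-! ### Second derivatives along a line -/

theorem dotProduct_hessianMatrix_mulVec {ι : Type} [Fintype ι] [DecidableEq ι]
    {f : (ι → ℝ) → ℝ} {η : ι → ℝ} (hf : ContDiffAt ℝ 2 f η) (v : ι → ℝ) :
    v ⬝ᵥ (hessianMatrix f η).mulVec v = fderiv ℝ (fderiv ℝ f) η v v := by
  have hd : DifferentiableAt ℝ (fderiv ℝ f) η :=
    (hf.fderiv_right (m := 1) (by norm_num)).differentiableAt (by norm_num)
  have hentry : ∀ a b, hessianMatrix f η a b
      = fderiv ℝ (fderiv ℝ f) η (Pi.single a 1) (Pi.single b 1) := by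
    intro a b
    simp only [hessianMatrix, Matrix.of_apply]
    rw [fderiv_clm_apply hd (differentiableAt_const _)]
    simp
  have hv : v = ∑ a, v a • (Pi.single a 1 : ι → ℝ) := pi_eq_sum_univ' v
  conv_rhs => rw [hv]
  simp only [dotProduct, Matrix.mulVec, hentry, map_sum, map_smul,
    sum_apply, smul_apply, smul_eq_mul]
  simp only [Finset.mul_sum]
  rw [Finset.sum_comm]
  refine Finset.sum_congr rfl fun a _ => Finset.sum_congr rfl fun b _ => ?_
  ring

theorem isHermitian_hessianMatrix {ι : Type} [Fintype ι] [DecidableEq ι]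
    {f : (ι → ℝ) → ℝ} {η : ι → ℝ} (hf : ContDiffAt ℝ 2 f η) :
    (hessianMatrix f η).IsHermitian := by
  have hd : DifferentiableAt ℝ (fderiv ℝ f) η :=
    (hf.fderiv_right (m := 1) (by norm_num)).differentiableAt (by norm_num)
  have hs : IsSymmSndFDerivAt ℝ f η := hf.isSymmSndFDerivAt (by simp)
  ext a b
  simp only [hessianMatrix, Matrix.conjTranspose_apply, Matrix.of_apply, star_trivial]
  rw [fderiv_clm_apply hd (differentiableAt_const _),
    fderiv_clm_apply hd (differentiableAt_const _)]
  simpa using hs.eq _ _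

theorem deriv_deriv_comp_line {E : Type*} [NormedAddCommGroup E] [NormedSpace ℝ E]
    {f : E → ℝ} {η : E} (hf : ContDiffAt ℝ 2 f η) (v : E) :
    deriv (deriv fun t : ℝ => f (η + t • v)) 0 = fderiv ℝ (fderiv ℝ f) η v v := by
  have hl : ∀ t : ℝ, HasDerivAt (fun t : ℝ => η + t • v) v t := fun t => by
    simpa using ((hasDerivAt_id t).smul_const v).const_add η
  have hl0 : Tendsto (fun t : ℝ => η + t • v) (𝓝 0) (𝓝 η) := by
    simpa using (hl 0).continuousAt.tendsto
  have hfd : ∀ᶠ ζ in 𝓝 η, DifferentiableAt ℝ f ζ :=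
    (hf.eventually (by simp)).mono fun ζ h => h.differentiableAt (by norm_num)
  have h1 : (deriv fun t : ℝ => f (η + t • v)) =ᶠ[𝓝 0]
      fun t => fderiv ℝ f (η + t • v) v := by
    filter_upwards [hl0.eventually hfd] with t ht
    exact (ht.hasFDerivAt.comp_hasDerivAt t (hl t)).deriv
  have hd : HasFDerivAt (fderiv ℝ f) (fderiv ℝ (fderiv ℝ f) η) (η + (0 : ℝ) • v) := by
    rw [zero_smul, add_zero]
    exact ((hf.fderiv_right (m := 1) (by norm_num)).differentiableAt (by norm_num)).hasFDerivAt
  have h2 : HasDerivAt (fun t : ℝ => fderiv ℝ f (η + t • v)) (fderiv ℝ (fderiv ℝ f) η v) 0 :=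
    hd.comp_hasDerivAt (0 : ℝ) (hl 0)
  have h3 : HasDerivAt (fun t : ℝ => fderiv ℝ f (η + t • v) v)
      (fderiv ℝ (fderiv ℝ f) η v v) 0 :=
    ((ContinuousLinearMap.apply ℝ ℝ v).hasFDerivAt.comp_hasDerivAt (0 : ℝ) h2)
  rw [h1.deriv_eq, h3.deriv]

/-- By the spectral theorem, a direction of negative curvature forces a negative eigenvalue of the
Hessian matrix. -/
theorem exists_neg_eigenvalue_hessianMatrix {ι : Type} [Fintype ι] [DecidableEq ι]
    {f : (ι → ℝ) → ℝ} {η : ι → ℝ} (hf : ContDiffAt ℝ 2 f η) {v : ι → ℝ}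
    (hv : deriv (deriv fun t : ℝ => f (η + t • v)) 0 < 0) :
    ∃ μ : ℝ, μ < 0 ∧ Module.End.HasEigenvalue (Matrix.toLin' (hessianMatrix f η)) μ := by
  have hH := isHermitian_hessianMatrix hf
  by_contra! hcon
  have hpos : (hessianMatrix f η).PosSemidef := by
    refine hH.posSemidef_iff_eigenvalues_nonneg.2 fun i => ?_
    by_contra! hneg
    refine hcon _ hneg ?_
    refine Module.End.hasEigenvalue_of_hasEigenvector
      (x := (WithLp.ofLp (hH.eigenvectorBasis i))) ⟨?_, ?_⟩
    · rw [Module.End.mem_eigenspace_iff, Matrix.toLin'_apply, hH.mulVec_eigenvectorBasis]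
    · intro h0
      exact hH.eigenvectorBasis.orthonormal.ne_zero i (by ext j; exact congrFun h0 j)
  have h := hpos.dotProduct_mulVec_nonneg v
  rw [star_trivial, dotProduct_hessianMatrix_mulVec hf, ← deriv_deriv_comp_line hf] at h
  exact absurd h (not_le.2 hv)

/-- The necessary second-order condition: at a local minimum, a critical point with negative second
derivative would also be a local maximum, so the function would be locally constant. -/
theorem not_isLocalMin_of_deriv_deriv_neg {g : ℝ → ℝ} {x : ℝ} (hc : ContinuousAt g x)
    (hg : deriv (deriv g) x < 0) : ¬ IsLocalMin g x := by
  intro hmin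
  have hmax := isLocalMax_of_deriv_deriv_neg hg hmin.deriv_eq_zero hc
  have hconst : g =ᶠ[𝓝 x] fun _ => g x := by
    filter_upwards [hmin, hmax] with y h1 h2 using le_antisymm h2 h1
  rw [hconst.deriv.deriv_eq] at hg
  simp at hg

/-! ### The number `ρ` and its threshold -/

theorem rho_denominator_pos (z : ℝ) (hz : 0 < z) : 0 < 1 + z - z ^ 2 + z ^ 3 := by
  nlinarith [mul_pos hz (show 0 < z ^ 2 - z + 1 by nlinarith [sq_nonneg (z - 1 / 2)])]

theorem rho_eq (J : ℝ) : rho J = (2 + 4 / (1 + Real.exp (2 * J) - Real.exp (2 * J) ^ 2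
    + Real.exp (2 * J) ^ 3))⁻¹ := by
  rw [rho, ← Real.exp_nat_mul, ← Real.exp_nat_mul]
  ring_nf

theorem rho_pos (J : ℝ) : 0 < rho J := by
  have := rho_denominator_pos _ (Real.exp_pos (2 * J))
  rw [rho_eq]; positivity

theorem rho_lt_half (J : ℝ) : rho J < 1 / 2 := by
  have := rho_denominator_pos _ (Real.exp_pos (2 * J))
  rw [rho_eq, inv_lt_comm₀ (by positivity) (by positivity)]
  have : 0 < 4 / (1 + Real.exp (2 * J) - Real.exp (2 * J) ^ 2 + Real.exp (2 * J) ^ 3) := by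
    positivity
  linarith

theorem three_eighths_lt_rho_iff (J : ℝ) :
    3 / 8 < rho J ↔ 5 < Real.exp (2 * J) - Real.exp (2 * J) ^ 2 + Real.exp (2 * J) ^ 3 := by
  have hD := rho_denominator_pos _ (Real.exp_pos (2 * J))
  rw [rho_eq, lt_inv_comm₀ (by positivity) (by positivity), ← lt_sub_iff_add_lt', div_lt_iff₀ hD]
  constructor <;> intro h <;> linarith

theorem cubic_strictMono {y z : ℝ} (h : y < z) : y - y ^ 2 + y ^ 3 < z - z ^ 2 + z ^ 3 := by
  nlinarith [mul_pos (sub_pos.2 h) (show 0 < 1 - (y + z) + (y ^ 2 + y * z + z ^ 2) by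
    nlinarith [sq_nonneg (y + z - 2 / 3), sq_nonneg (y - z)])]

theorem exists_rho_threshold :
    ∃ Jc : ℝ, 0.3155 < Jc ∧ Jc < 0.316 ∧ ∀ J : ℝ, 3 / 8 < rho J ↔ Jc < J := by
  -- The root of `z - z² + z³ = 5` is `z ≈ 1.88123`; it lies between `e^{2 · 0.3155}` and
  -- `e^{2 · 0.316}`.
  have hlow : Real.exp 0.631 < 1.8797 := by
    refine lt_of_le_of_lt (Real.exp_bound' (n := 8) (by norm_num) (by norm_num) (by norm_num)) ?_
    norm_num [Finset.sum_range_succ, Nat.factorial]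
  have hhigh : 1.8813 < Real.exp 0.632 := by
    refine lt_of_lt_of_le ?_ (Real.sum_le_exp_of_nonneg (by norm_num) 8)
    norm_num [Finset.sum_range_succ, Nat.factorial]
  have hcont : ContinuousOn (fun z : ℝ => z - z ^ 2 + z ^ 3) (Set.Icc 1.8797 1.8813) := by fun_prop
  obtain ⟨z, ⟨hz1, hz2⟩, hz⟩ := intermediate_value_Icc (by norm_num) hcont
    (show (5 : ℝ) ∈ _ by constructor <;> norm_num)
  have hz0 : 0 < z := lt_of_lt_of_le (by norm_num) hz1
  refine ⟨Real.log z / 2, ?_, ?_, fun J => ?_⟩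
  · have : 0.631 < Real.log z := (Real.lt_log_iff_exp_lt hz0).2 (hlow.trans_le hz1)
    linarith
  · have : Real.log z < 0.632 := (Real.log_lt_iff_lt_exp hz0).2 (hz2.trans_lt hhigh)
    linarith
  · have hmono : StrictMono fun z : ℝ => z - z ^ 2 + z ^ 3 := fun _ _ h => cubic_strictMono h
    rw [three_eighths_lt_rho_iff, ← hz, hmono.lt_iff_lt, ← Real.log_lt_iff_lt_exp hz0,
      div_lt_iff₀ two_pos, mul_comm J]

/-! ### The true marginals of the four-node model -/

theorem sum_boolPairs {β : Type*} [AddCommMonoid β] (f : (Fin 2 → Bool) → β) :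
    ∑ y, f y = f ![true, true] + f ![true, false] + f ![false, true] + f ![false, false] := by
  rw [← (finTwoArrowEquiv Bool).symm.sum_comp, Fintype.sum_prod_type]
  simp [finTwoArrowEquiv, add_assoc]

theorem sum_boolSingles {β : Type*} [AddCommMonoid β] (f : (Fin 1 → Bool) → β) :
    ∑ y, f y = f ![true] + f ![false] := by
  rw [← (Equiv.funUnique (Fin 1) Bool).symm.sum_comp]
  simp only [Fintype.sum_bool]
  congr 2 <;> (ext i; fin_cases i; rfl)

theorem sum_boolQuadruples (f : (Fin 4 → Bool) → ℝ) :
    ∑ x, f x = ∑ a, ∑ b, ∑ c, ∑ d, f ![a, b, c, d] := by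
  rw [← (Fin.consEquiv fun _ => Bool).sum_comp, Fintype.sum_prod_type]
  refine Finset.sum_congr rfl fun a _ => ?_
  rw [← (Fin.consEquiv fun _ => Bool).sum_comp, Fintype.sum_prod_type]
  refine Finset.sum_congr rfl fun b _ => ?_
  rw [sum_boolPairs]
  simp only [Fin.consEquiv, Equiv.coe_fn_mk, Fintype.sum_bool, add_assoc]
  rfl

theorem sum_fin_four_pairs (f : Fin 4 × Fin 4 → ℝ) :
    ∑ e : {e : Fin 4 × Fin 4 // e.1 < e.2}, f e.1
      = f (0, 1) + f (0, 2) + f (0, 3) + f (1, 2) + f (1, 3) + f (2, 3) := by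
  rw [← Finset.sum_subtype (Finset.univ.filter fun e : Fin 4 × Fin 4 => e.1 < e.2)
    (by simp) f, Finset.sum_filter, Fintype.sum_prod_type]
  simp [Fin.sum_univ_four, add_assoc]

@[simp] theorem spin_true : spin true = 1 := rfl
@[simp] theorem spin_false : spin false = -1 := rfl

theorem energy_isingCoupling (J : ℝ) (x : Fin 4 → Bool) :
    -(isingModel 4).energy (isingCoupling 4 J) x
      = J * (((∑ i, spin (x i)) ^ 2 - ∑ i, spin (x i) ^ 2) / 2) := by
  simp only [GraphicalModel.energy, Fintype.sum_sum_type]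
  have h : ∀ e : {e : Fin 4 × Fin 4 // e.1 < e.2},
      ∑ k : Fin 1, isingCoupling 4 J (.inr e) k *
        ∏ l : Fin 2, spin (x (![e.1.1, e.1.2] l)) = J * (spin (x e.1.1) * spin (x e.1.2)) := by
    intro e; simp [isingCoupling]
  have h0 : ∀ i : Fin 4, ∑ k : Fin 1, isingCoupling 4 J (.inl i) k *
        ∏ l : Fin 1, spin (x (![i] l)) = 0 := by
    intro e; simp [isingCoupling]
  erw [Finset.sum_congr rfl fun e _ => h e, Finset.sum_congr rfl fun e _ => h0 e]
  rw [sum_fin_four_pairs fun e => J * (spin (x e.1) * spin (x e.2))]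
  simp only [Fin.sum_univ_four, Finset.sum_const_zero]
  ring

/-- The Boltzmann weights, multiplied by `e^{2J}` and written with `z = e^{2J}`, are polynomials:
a state with all spins equal has weight `z⁴`, one with two spins of each sign has weight `1`, and
one with a single deviating spin has weight `z`. -/
def couplingWeight (z : ℝ) (x : Fin 4 → Bool) : ℝ :=
  if ∑ i, (x i).toNat = 0 ∨ ∑ i, (x i).toNat = 4 then z ^ 4 else
    if ∑ i, (x i).toNat = 2 then 1 else z

theorem couplingWeight_vec (z : ℝ) (a b c d : Bool) :
    couplingWeight z ![a, b, c, d] =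
      if a.toNat + b.toNat + c.toNat + d.toNat = 0 ∨ a.toNat + b.toNat + c.toNat + d.toNat = 4
      then z ^ 4 else if a.toNat + b.toNat + c.toNat + d.toNat = 2 then 1 else z := by
  simp only [couplingWeight, Fin.sum_univ_four]
  rfl

theorem boltzmann_isingCoupling (J : ℝ) (x : Fin 4 → Bool) :
    (isingModel 4).boltzmann (isingCoupling 4 J) x
      = couplingWeight (Real.exp (2 * J)) x / ∑ z, couplingWeight (Real.exp (2 * J)) z := by
  have h : ∀ x, Real.exp (-(isingModel 4).energy (isingCoupling 4 J) x)
      = Real.exp (-(2 * J)) * couplingWeight (Real.exp (2 * J)) x := by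
    intro x
    have hx : x = ![x 0, x 1, x 2, x 3] := by ext i; fin_cases i <;> rfl
    rw [energy_isingCoupling, hx, couplingWeight_vec, ← Real.exp_nat_mul]
    simp only [Fin.sum_univ_four]
    change Real.exp (J * (((spin (x 0) + spin (x 1) + spin (x 2) + spin (x 3)) ^ 2
      - (spin (x 0) ^ 2 + spin (x 1) ^ 2 + spin (x 2) ^ 2 + spin (x 3) ^ 2)) / 2)) = _
    cases x 0 <;> cases x 1 <;> cases x 2 <;> cases x 3 <;>
      norm_num [← Real.exp_add] <;> ring_nf
  simp only [GraphicalModel.boltzmann, h, ← Finset.mul_sum]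
  rw [mul_div_mul_left _ _ (Real.exp_pos _).ne']

theorem sum_couplingWeight (z : ℝ) : ∑ x, couplingWeight z x = 2 * z ^ 4 + 8 * z + 6 := by
  rw [sum_boolQuadruples]
  simp [couplingWeight_vec]
  ring

theorem sum_couplingWeight_node (z : ℝ) (i : Fin 4) (s : Bool) :
    ∑ x with x i = s, couplingWeight z x = z ^ 4 + 4 * z + 3 := by
  rw [Finset.sum_filter, sum_boolQuadruples]
  fin_cases i <;> cases s <;>
    simp [couplingWeight_vec] <;> ring

theorem sum_couplingWeight_pair (z : ℝ) (i j : Fin 4) (hij : i < j) (s t : Bool) :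
    ∑ x with x i = s ∧ x j = t, couplingWeight z x
      = if s = t then z ^ 4 + 2 * z + 1 else 2 * z + 2 := by
  rw [Finset.sum_filter, sum_boolQuadruples]
  fin_cases i <;> fin_cases j <;> first | exact absurd hij (by decide) | skip
  all_goals cases s <;> cases t <;>
    simp [couplingWeight_vec] <;> ring

theorem fourNodeMarginals_node (J : ℝ) (i : Fin 4) (s : Bool) :
    (fourNodeMarginals J).1 i s = 1 / 2 := by
  have hz := Real.exp_pos (2 * J)
  simp only [fourNodeMarginals, GraphicalModel.marginals, boltzmann_isingCoupling,
    ← Finset.sum_div, sum_couplingWeight, sum_couplingWeight_node]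
  field_simp
  ring

theorem fourNodeMarginals_single (J : ℝ) (i : Fin 4) (s : Bool) :
    (fourNodeMarginals J).2 (.inl i) ![s] = 1 / 2 := by
  rw [← fourNodeMarginals_node J i s]
  simp only [fourNodeMarginals, GraphicalModel.marginals]
  refine Finset.sum_congr (Finset.ext fun x => ?_) fun _ _ => rfl
  simp only [Finset.mem_filter, Finset.mem_univ, true_and]
  constructor
  · intro h; exact congrFun h (0 : Fin 1)
  · intro h; ext k; fin_cases k; exact h

/-- The sums of the weights give `ρ = (z⁴ + 2z + 1) / (2z⁴ + 8z + 6)` with `z = e^{2J}`; the closed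
form of `ρ` results from cancelling the factor `1 + z`. -/
theorem fourNodeMarginals_pair (J : ℝ) (e : {e : Fin 4 × Fin 4 // e.1 < e.2}) (s t : Bool) :
    (fourNodeMarginals J).2 (.inr e) ![s, t] = if s = t then rho J else 1 / 2 - rho J := by
  have hz := Real.exp_pos (2 * J)
  have hD := rho_denominator_pos _ hz
  have h : (fourNodeMarginals J).2 (.inr e) ![s, t]
      = ∑ x with x e.1.1 = s ∧ x e.1.2 = t, (isingModel 4).boltzmann (isingCoupling 4 J) x := by
    simp only [fourNodeMarginals, GraphicalModel.marginals]
    refine Finset.sum_congr (Finset.ext fun x => ?_) fun _ _ => rfl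
    simp only [Finset.mem_filter, Finset.mem_univ, true_and]
    constructor
    · intro h; exact ⟨congrFun h (0 : Fin 2), congrFun h (1 : Fin 2)⟩
    · rintro ⟨h0, h1⟩; ext k; fin_cases k
      · exact h0
      · exact h1
  rw [h]
  simp only [boltzmann_isingCoupling, ← Finset.sum_div, sum_couplingWeight,
    sum_couplingWeight_pair _ _ _ e.2]
  rw [rho_eq]
  set z := Real.exp (2 * J)
  have h1 : (2 + 4 / (1 + z - z ^ 2 + z ^ 3))⁻¹ = (z ^ 4 + 2 * z + 1) / (2 * z ^ 4 + 8 * z + 6) := by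
    rw [inv_eq_one_div, div_eq_div_iff (by positivity) (by positivity)]
    field_simp
    ring
  rw [h1]
  split_ifs
  · rfl
  · field_simp
    ring

theorem isingCoords_fourNodeMarginals_inl (J : ℝ) (i : Fin 4) :
    isingCoords 4 (fourNodeMarginals J) (.inl i) = 1 / 2 := by
  rw [← fourNodeMarginals_single J i true]
  refine congrArg ((fourNodeMarginals J).2 (.inl i)) ?_
  ext k; fin_cases k; rfl

theorem isingCoords_fourNodeMarginals_inr (J : ℝ) (e : {e : Fin 4 × Fin 4 // e.1 < e.2}) :
    isingCoords 4 (fourNodeMarginals J) (.inr e) = rho J := by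
  have h := fourNodeMarginals_pair J e true true
  rw [if_pos rfl] at h
  rw [← h]
  refine congrArg ((fourNodeMarginals J).2 (.inr e)) ?_
  ext k; fin_cases k <;> rfl

theorem isingPseudo_isingCoords_fourNodeMarginals (J : ℝ) :
    isingPseudo 4 (isingCoords 4 (fourNodeMarginals J)) = fourNodeMarginals J := by
  refine Prod.ext ?_ ?_
  · funext i s
    rw [fourNodeMarginals_node]
    cases s <;> norm_num [isingPseudo, isingCoords_fourNodeMarginals_inl]
  · funext α
    rcases α with i | e
    · funext y
      have hy : y = ![y (0 : Fin 1)] := by ext k; fin_cases k; rfl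
      rw [hy]
      refine Eq.trans ?_ (fourNodeMarginals_single J i _).symm
      cases y (0 : Fin 1) <;> norm_num [isingPseudo, isingCoords_fourNodeMarginals_inl]
    · funext y
      have hy : y = ![y (0 : Fin 2), y (1 : Fin 2)] := by ext k; fin_cases k <;> rfl
      rw [hy]
      refine Eq.trans ?_ (fourNodeMarginals_pair J e _ _).symm
      cases y (0 : Fin 2) <;> cases y (1 : Fin 2) <;>
        norm_num [isingPseudo, isingCoords_fourNodeMarginals_inl,
          isingCoords_fourNodeMarginals_inr]

/-! ### Negative curvature of the Bethe free energy -/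

theorem degree_isingModel_four (i : Fin 4) : (isingModel 4).degree i = 4 := by
  have h : (Finset.univ.filter fun α : IsingFactor 4 => ∃ l, isingVar α l = i).card = 4 := by
    revert i; decide
  exact h

theorem averageEnergy_isingPseudo (n : ℕ) (θ : (isingModel n).Params) (η : IsingFactor n → ℝ) :
    (isingModel n).averageEnergy θ (isingPseudo n η) =
      -(∑ i, θ (.inl i) (0 : Fin 1) * (2 * η (.inl i) - 1)
        + ∑ e : {e : Fin n × Fin n // e.1 < e.2}, θ (.inr e) (0 : Fin 1) *
          (1 - 2 * η (.inl e.1.1) - 2 * η (.inl e.1.2) + 4 * η (.inr e))) := by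
  simp only [GraphicalModel.averageEnergy, Fintype.sum_sum_type]
  congr 2
  · refine Finset.sum_congr rfl fun i _ => ?_
    erw [Fin.sum_univ_one]
    congr 1
    erw [sum_boolSingles]
    simp [isingPseudo]
    ring
  · refine Finset.sum_congr rfl fun e _ => ?_
    erw [Fin.sum_univ_one]
    congr 1
    erw [sum_boolPairs]
    simp [isingPseudo]
    ring

/-- A node has degree `4`, which gives its entropy the coefficient `-3`; the entropy of the
single-node factor adds one more, so that the coefficient is `-2` in total. -/
theorem betheEntropy_isingPseudo_four (η : IsingFactor 4 → ℝ) :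
    (isingModel 4).betheEntropy (isingPseudo 4 η) =
      ∑ e : {e : Fin 4 × Fin 4 // e.1 < e.2},
          (Real.negMulLog (η (.inr e)) + Real.negMulLog (η (.inl e.1.1) - η (.inr e))
            + Real.negMulLog (η (.inl e.1.2) - η (.inr e))
            + Real.negMulLog (1 - η (.inl e.1.1) - η (.inl e.1.2) + η (.inr e)))
        - 2 * ∑ i, (Real.negMulLog (η (.inl i)) + Real.negMulLog (1 - η (.inl i))) := by
  simp only [GraphicalModel.betheEntropy, Fintype.sum_sum_type, degree_isingModel_four]
  have h1 : ∀ i : Fin 4, ∑ y : Fin 1 → Bool,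
      Real.negMulLog ((isingPseudo 4 η).2 (.inl i) y)
        = Real.negMulLog (η (.inl i)) + Real.negMulLog (1 - η (.inl i)) := by
    intro i; rw [sum_boolSingles]; simp [isingPseudo]
  have h2 : ∀ e : {e : Fin 4 × Fin 4 // e.1 < e.2}, ∑ y : Fin 2 → Bool,
      Real.negMulLog ((isingPseudo 4 η).2 (.inr e) y)
        = Real.negMulLog (η (.inr e)) + Real.negMulLog (η (.inl e.1.1) - η (.inr e))
            + Real.negMulLog (η (.inl e.1.2) - η (.inr e))
            + Real.negMulLog (1 - η (.inl e.1.1) - η (.inl e.1.2) + η (.inr e)) := by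
    intro e; rw [sum_boolPairs]; simp [isingPseudo]
  have h3 : ∀ i : Fin 4, ∑ s : Bool, Real.negMulLog ((isingPseudo 4 η).1 i s)
        = Real.negMulLog (η (.inl i)) + Real.negMulLog (1 - η (.inl i)) := by
    intro i; simp [isingPseudo]
  erw [Finset.sum_congr rfl fun i _ => h1 i, Finset.sum_congr rfl fun e _ => h2 e]
  simp only [h3, ← Finset.mul_sum]
  push_cast
  ring

theorem contDiffAt_negMulLog {x : ℝ} (hx : x ≠ 0) : ContDiffAt ℝ 2 Real.negMulLog x :=
  contDiffAt_id.neg.mul (Real.contDiffAt_log.2 hx)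

theorem isingBethe_four (θ : (isingModel 4).Params) (η : IsingFactor 4 → ℝ) :
    isingBethe 4 θ η =
      -(∑ i, θ (.inl i) (0 : Fin 1) * (2 * η (.inl i) - 1)
        + ∑ e : {e : Fin 4 × Fin 4 // e.1 < e.2}, θ (.inr e) (0 : Fin 1) *
          (1 - 2 * η (.inl e.1.1) - 2 * η (.inl e.1.2) + 4 * η (.inr e)))
      - (∑ e : {e : Fin 4 × Fin 4 // e.1 < e.2},
          (Real.negMulLog (η (.inr e)) + Real.negMulLog (η (.inl e.1.1) - η (.inr e))
            + Real.negMulLog (η (.inl e.1.2) - η (.inr e))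
            + Real.negMulLog (1 - η (.inl e.1.1) - η (.inl e.1.2) + η (.inr e)))
        - 2 * ∑ i, (Real.negMulLog (η (.inl i)) + Real.negMulLog (1 - η (.inl i)))) := by
  rw [isingBethe, GraphicalModel.betheFreeEnergy, averageEnergy_isingPseudo,
    betheEntropy_isingPseudo_four]

theorem contDiffAt_isingBethe_four (θ : (isingModel 4).Params) {η : IsingFactor 4 → ℝ}
    (h1 : ∀ i, η (.inl i) ≠ 0) (h2 : ∀ i, 1 - η (.inl i) ≠ 0)
    (h3 : ∀ e, η (.inr e) ≠ 0) (h4 : ∀ e, η (.inl e.1.1) - η (.inr e) ≠ 0)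
    (h5 : ∀ e, η (.inl e.1.2) - η (.inr e) ≠ 0)
    (h6 : ∀ e, 1 - η (.inl e.1.1) - η (.inl e.1.2) + η (.inr e) ≠ 0) :
    ContDiffAt ℝ 2 (isingBethe 4 θ) η := by
  have hfun : isingBethe 4 θ = _ := funext (isingBethe_four θ)
  rw [hfun]
  have hlog : ∀ {g : (IsingFactor 4 → ℝ) → ℝ}, ContDiff ℝ 2 g → g η ≠ 0 →
      ContDiffAt ℝ 2 (fun ζ => Real.negMulLog (g ζ)) η := fun hg h0 =>
    (contDiffAt_negMulLog h0).comp η hg.contDiffAt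
  refine ContDiffAt.sub (ContDiff.contDiffAt (by fun_prop)) (ContDiffAt.sub ?_ ?_)
  · refine ContDiffAt.sum fun e _ => ((ContDiffAt.add ?_ ?_).add ?_).add ?_
    · exact hlog (g := fun ζ => ζ (.inr e)) (by fun_prop) (h3 e)
    · exact hlog (g := fun ζ => ζ (.inl e.1.1) - ζ (.inr e)) (by fun_prop) (h4 e)
    · exact hlog (g := fun ζ => ζ (.inl e.1.2) - ζ (.inr e)) (by fun_prop) (h5 e)
    · exact hlog (g := fun ζ => 1 - ζ (.inl e.1.1) - ζ (.inl e.1.2) + ζ (.inr e))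
        (by fun_prop) (h6 e)
  · refine contDiffAt_const.mul (ContDiffAt.sum fun i _ => ContDiffAt.add ?_ ?_)
    · exact hlog (g := fun ζ => ζ (.inl i)) (by fun_prop) (h1 i)
    · exact hlog (g := fun ζ => 1 - ζ (.inl i)) (by fun_prop) (h2 i)

theorem contDiffAt_isingBethe_fourNodeMarginals (J : ℝ) (θ : (isingModel 4).Params) :
    ContDiffAt ℝ 2 (isingBethe 4 θ) (isingCoords 4 (fourNodeMarginals J)) := by
  have h0 := rho_pos J
  have h1 := rho_lt_half J
  apply contDiffAt_isingBethe_four <;> intro e <;>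
    simp only [isingCoords_fourNodeMarginals_inl, isingCoords_fourNodeMarginals_inr] <;>
    linarith

/-- Along the direction that raises all coordinates `q_i(+1)` and `q_ij(+1, +1)` at the same rate,
the probabilities `q_ij(x_i, x_j)` with `x_i ≠ x_j` are constant and the energy is affine. -/
theorem isingBethe_line (J : ℝ) (θ : (isingModel 4).Params) : ∃ A B : ℝ, ∀ t : ℝ,
    isingBethe 4 θ (isingCoords 4 (fourNodeMarginals J) + t • 1) = A + B * t
      - 6 * (Real.negMulLog (rho J + t) + Real.negMulLog (rho J - t))
      + 8 * (Real.negMulLog (1 / 2 + t) + Real.negMulLog (1 / 2 - t)) := by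
  refine ⟨-(∑ e : {e : Fin 4 × Fin 4 // e.1 < e.2}, θ (.inr e) (0 : Fin 1) * (4 * rho J - 1))
    - 12 * Real.negMulLog (1 / 2 - rho J), -(∑ i, θ (.inl i) (0 : Fin 1) * 2), fun t => ?_⟩
  rw [isingBethe_four]
  simp only [Pi.add_apply, Pi.smul_apply, Pi.one_apply, smul_eq_mul, mul_one,
    isingCoords_fourNodeMarginals_inl, isingCoords_fourNodeMarginals_inr]
  have e1 : ∀ c : ℝ, c * (2 * (1 / 2 + t) - 1) = c * 2 * t := fun c => by ring
  have e2 : 1 - 2 * (1 / 2 + t) - 2 * (1 / 2 + t) + 4 * (rho J + t) = 4 * rho J - 1 := by ring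
  have e3 : 1 / 2 + t - (rho J + t) = 1 / 2 - rho J := by ring
  have e4 : 1 / 2 - t - (1 / 2 + t) + (rho J + t) = rho J - t := by ring
  have e5 : 1 - (1 / 2 + t) = 1 / 2 - t := by ring
  have hcard : Fintype.card {e : Fin 4 × Fin 4 // e.1 < e.2} = 6 := by decide
  simp only [e1, e2, e3, e4, e5, ← Finset.sum_mul, Finset.sum_const, Finset.card_univ, hcard,
    Fintype.card_fin, nsmul_eq_mul]
  push_cast
  ring

theorem deriv_deriv_entropy_line (A B ρ : ℝ) (hρ : 0 < ρ) :
    deriv (deriv fun t : ℝ => A + B * t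
      - 6 * (Real.negMulLog (ρ + t) + Real.negMulLog (ρ - t))
      + 8 * (Real.negMulLog (1 / 2 + t) + Real.negMulLog (1 / 2 - t))) 0 = 12 / ρ - 32 := by
  have hshift : ∀ r : ℝ, 0 < r → ∀ᶠ t in 𝓝 (0 : ℝ), 0 < r + t ∧ 0 < r - t := by
    intro r hr
    filter_upwards [Ioo_mem_nhds (neg_neg_of_pos hr) hr] with t ht
    exact ⟨by linarith [ht.1], by linarith [ht.2]⟩
  have hD : ∀ r t : ℝ, 0 < r + t → 0 < r - t → HasDerivAt
      (fun t => Real.negMulLog (r + t) + Real.negMulLog (r - t))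
      (Real.log (r - t) - Real.log (r + t)) t := by
    intro r t h1 h2
    have a := (Real.hasDerivAt_negMulLog h1.ne').comp t ((hasDerivAt_id t).const_add r)
    have b := (Real.hasDerivAt_negMulLog h2.ne').comp t ((hasDerivAt_id t).const_sub r)
    exact (a.add b).congr_deriv (by ring)
  have hD2 : ∀ r : ℝ, 0 < r → HasDerivAt
      (fun t => Real.log (r - t) - Real.log (r + t)) (-(2 / r)) 0 := by
    intro r hr
    have a := ((hasDerivAt_id (0 : ℝ)).const_add r).log (by simpa using hr.ne')
    have b := ((hasDerivAt_id (0 : ℝ)).const_sub r).log (by simpa using hr.ne')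
    exact (b.sub a).congr_deriv (by simp only [id_eq, add_zero, sub_zero]; ring)
  have h1 : (deriv fun t : ℝ => A + B * t
      - 6 * (Real.negMulLog (ρ + t) + Real.negMulLog (ρ - t))
      + 8 * (Real.negMulLog (1 / 2 + t) + Real.negMulLog (1 / 2 - t))) =ᶠ[𝓝 0] fun t =>
      B - 6 * (Real.log (ρ - t) - Real.log (ρ + t))
        + 8 * (Real.log (1 / 2 - t) - Real.log (1 / 2 + t)) := by
    filter_upwards [hshift ρ hρ, hshift (1 / 2) (by norm_num)] with t h h'
    have hB : HasDerivAt (fun t => A + B * t) B t := by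
      simpa using ((hasDerivAt_id t).const_mul B).const_add A
    exact ((hB.sub ((hD ρ t h.1 h.2).const_mul 6)).add
      ((hD (1 / 2) t h'.1 h'.2).const_mul 8)).deriv
  have h2 := (((hD2 ρ hρ).const_mul 6).const_sub B).add
    ((hD2 (1 / 2) (by norm_num)).const_mul 8)
  rw [h1.deriv_eq, show (12 / ρ - 32 : ℝ) = -(6 * -(2 / ρ)) + 8 * -(2 / (1 / 2)) by ring]
  exact h2.deriv

theorem deriv_deriv_isingBethe_line (J : ℝ) (θ : (isingModel 4).Params) :
    deriv (deriv fun t : ℝ =>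
      isingBethe 4 θ (isingCoords 4 (fourNodeMarginals J) + t • 1)) 0 = 12 / rho J - 32 := by
  obtain ⟨A, B, h⟩ := isingBethe_line J θ
  simp only [h]
  exact deriv_deriv_entropy_line A B _ (rho_pos J)

theorem curvature_neg {J : ℝ} (hJ : 3 / 8 < rho J) : 12 / rho J - 32 < 0 := by
  rw [sub_neg, div_lt_iff₀ (rho_pos J)]
  linarith

/-- Pseudomarginals in minimal coordinates satisfy the normalization and consistency constraints
identically, so only nonnegativity remains to be checked. -/
theorem isingPseudo_mem_pseudomarginals {n : ℕ} {η : IsingFactor n → ℝ}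
    (h1 : ∀ i, 0 ≤ η (.inl i) ∧ η (.inl i) ≤ 1)
    (h3 : ∀ e, 0 ≤ η (.inr e)) (h4 : ∀ e, η (.inr e) ≤ η (.inl e.1.1))
    (h5 : ∀ e, η (.inr e) ≤ η (.inl e.1.2))
    (h6 : ∀ e, 0 ≤ 1 - η (.inl e.1.1) - η (.inl e.1.2) + η (.inr e)) :
    isingPseudo n η ∈ (isingModel n).pseudomarginals := by
  refine ⟨?_, ?_, ?_, ?_⟩
  · rintro (i | e) y
    · have := h1 i
      change 0 ≤ (if y (0 : Fin 1) then _ else _) ∧ (if y (0 : Fin 1) then _ else _) ≤ _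
      split_ifs <;> constructor <;> linarith
    · have hi := h1 e.1.1; have hj := h1 e.1.2
      have := h3 e; have := h4 e; have := h5 e; have := h6 e
      simp only [isingPseudo]
      cases y (0 : Fin 2) <;> cases y (1 : Fin 2) <;> constructor <;> simp only <;> linarith
  · rintro (i | e) k s
    · change ∑ y : Fin 1 → Bool with y k = s, (isingPseudo n η).2 (.inl i) y = _
      rw [Finset.sum_filter, sum_boolSingles]
      fin_cases k; cases s <;> simp [isingPseudo]
    · change ∑ y : Fin 2 → Bool with y k = s, (isingPseudo n η).2 (.inr e) y = _
      rw [Finset.sum_filter, sum_boolPairs]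
      fin_cases k <;> cases s <;> simp [isingPseudo]
      ring
  · intro i s
    have := h1 i
    cases s <;> simp only [isingPseudo] <;> constructor <;> simp <;> linarith
  · intro i; simp [isingPseudo]

theorem not_isLocalMinOn_betheFreeEnergy {J : ℝ} (hJ : 3 / 8 < rho J)
    (θ : (isingModel 4).Params) :
    ¬ IsLocalMinOn ((isingModel 4).betheFreeEnergy θ) (isingModel 4).pseudomarginals
      (fourNodeMarginals J) := by
  intro hmin
  have hρ := rho_pos J
  have hρ' := rho_lt_half J
  have hneg := deriv_deriv_isingBethe_line J θ
  have hline : Continuous fun t : ℝ => isingCoords 4 (fourNodeMarginals J) + t • 1 := by fun_prop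
  have hcont : ContinuousAt
      (fun t : ℝ => isingBethe 4 θ (isingCoords 4 (fourNodeMarginals J) + t • 1)) 0 :=
    ContinuousAt.comp (g := isingBethe 4 θ)
      (by simpa using (contDiffAt_isingBethe_fourNodeMarginals J θ).continuousAt)
      hline.continuousAt
  refine not_isLocalMin_of_deriv_deriv_neg hcont (hneg.trans_lt (curvature_neg hJ)) ?_
  have hpseudo : Continuous (isingPseudo 4) := by
    refine Continuous.prodMk ?_ ?_
    · refine continuous_pi fun i => continuous_pi fun s => ?_
      cases s <;> simp <;> fun_prop
    · refine continuous_pi fun α => continuous_pi fun y => ?_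
      rcases α with i | e
      · change Continuous fun η : IsingFactor 4 → ℝ =>
          if y (0 : Fin 1) then η (.inl i) else 1 - η (.inl i)
        split_ifs <;> fun_prop
      · dsimp only
        cases y (0 : Fin 2) <;> cases y (1 : Fin 2) <;> dsimp only <;> fun_prop
  have hlim : Tendsto
      (fun t : ℝ => isingPseudo 4 (isingCoords 4 (fourNodeMarginals J) + t • 1)) (𝓝 0)
      (𝓝[(isingModel 4).pseudomarginals] (fourNodeMarginals J)) := by
    refine tendsto_nhdsWithin_iff.2 ⟨?_, ?_⟩
    · have := (hpseudo.comp hline).tendsto 0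
      simpa [isingPseudo_isingCoords_fourNodeMarginals, Function.comp_def] using this
    · filter_upwards [Ioo_mem_nhds (neg_neg_of_pos hρ) hρ] with t ht
      have h1 := ht.1
      have h2 := ht.2
      apply isingPseudo_mem_pseudomarginals <;> intro e <;>
        simp only [Pi.add_apply, Pi.smul_apply, Pi.one_apply, smul_eq_mul, mul_one,
          isingCoords_fourNodeMarginals_inl, isingCoords_fourNodeMarginals_inr] <;>
        first | linarith | (constructor <;> linarith)
  filter_upwards [hlim.eventually hmin] with t ht
  simpa [isingBethe, isingPseudo_isingCoords_fourNodeMarginals] using ht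

/-! ### Belief propagation with the marginals of the four-node model -/

theorem normalized_bool (f : Bool → ℝ) (s : Bool) :
    GraphicalModel.normalized f s = f s / (f true + f false) := by
  simp [GraphicalModel.normalized]

theorem sum_boolPairs_fixed (f : (Fin 2 → Bool) → ℝ) (k : Fin 2) (s : Bool) :
    ∑ y with y k = s, f y = if k = 0 then f ![s, true] + f ![s, false]
      else f ![true, s] + f ![false, s] := by
  rw [Finset.sum_filter, sum_boolPairs]
  fin_cases k <;> cases s <;> simp

theorem potential_inr {n : ℕ} (θ : (isingModel n).Params)
    (e : {e : Fin n × Fin n // e.1 < e.2}) (s t : Bool) :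
    (isingModel n).potential θ (.inr e) ![s, t]
      = Real.exp (θ (.inr e) (0 : Fin 1) * (spin s * spin t)) := by
  rw [GraphicalModel.potential]
  erw [Fin.sum_univ_one]
  have h : ∏ l : Fin 2, spin (![s, t] l) = spin s * spin t := Fin.prod_univ_two _
  exact congrArg (fun r => Real.exp (θ (.inr e) (0 : Fin 1) * r)) h

theorem potential_inl {n : ℕ} (θ : (isingModel n).Params) (i : Fin n) (s : Bool) :
    (isingModel n).potential θ (.inl i) ![s]
      = Real.exp (θ (.inl i) (0 : Fin 1) * spin s) := by
  rw [GraphicalModel.potential]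
  erw [Fin.sum_univ_one]
  have h : ∏ l : Fin 1, spin (![s] l) = spin s := Fin.prod_univ_one _
  exact congrArg (fun r => Real.exp (θ (.inl i) (0 : Fin 1) * r)) h

theorem factorToNode_inl {n : ℕ} (θ : (isingModel n).Params) (m : (isingModel n).Messages)
    (i : Fin n) (s : Bool) :
    (isingModel n).factorToNode θ m (.inl i) (0 : Fin 1) s
      = Real.exp (θ (.inl i) (0 : Fin 1) * spin s)
        / (Real.exp (θ (.inl i) (0 : Fin 1)) + Real.exp (-θ (.inl i) (0 : Fin 1))) := by
  have h : ∀ s, (∑ y : Fin 1 → Bool with y 0 = s, (isingModel n).potential θ (.inl i) y *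
      ∏ j : Fin 1 with j ≠ 0, m (.inl i) j (y j))
        = Real.exp (θ (.inl i) (0 : Fin 1) * spin s) := by
    intro s
    rw [Finset.sum_filter, sum_boolSingles, potential_inl, potential_inl]
    have h0 : (Finset.univ.filter fun j : Fin 1 => j ≠ 0) = ∅ := by decide
    cases s <;> simp only [h0] <;> simp
  have h' := normalized_bool (fun s => Real.exp (θ (.inl i) (0 : Fin 1) * spin s)) s
  simp only [spin_true, spin_false, mul_one, mul_neg] at h'
  rw [← h', GraphicalModel.factorToNode]
  exact congrFun (congrArg GraphicalModel.normalized (funext h)) s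

/-- The message from a pair to its `k`-th node, in terms of the message `m` from its other node. -/
theorem factorToNode_inr {n : ℕ} (θ : (isingModel n).Params) (m : (isingModel n).Messages)
    (e : {e : Fin n × Fin n // e.1 < e.2}) (k : Fin 2) (s : Bool) :
    (isingModel n).factorToNode θ m (.inr e) k s = GraphicalModel.normalized (fun s =>
      Real.exp (θ (.inr e) (0 : Fin 1) * spin s) * m (.inr e) (1 - k : Fin 2) true
        + Real.exp (-(θ (.inr e) (0 : Fin 1) * spin s)) * m (.inr e) (1 - k : Fin 2) false) s := by
  have h : ∀ s, (∑ y : Fin 2 → Bool with y k = s, (isingModel n).potential θ (.inr e) y *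
      ∏ j : Fin 2 with j ≠ k, m (.inr e) j (y j))
        = Real.exp (θ (.inr e) (0 : Fin 1) * spin s) * m (.inr e) (1 - k : Fin 2) true
        + Real.exp (-(θ (.inr e) (0 : Fin 1) * spin s)) * m (.inr e) (1 - k : Fin 2) false := by
    intro s
    rw [sum_boolPairs_fixed]
    simp only [potential_inr, Finset.prod_filter, Fin.prod_univ_two]
    fin_cases k <;> simp
  exact congrFun (congrArg GraphicalModel.normalized (funext h)) s

/-- The messages with bias `u` on all pairs and no bias on the single-node factors. -/
noncomputable def biasedMessages (u : ℝ) : (isingModel 4).Messages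
  | .inl _ => fun _ _ => 1 / 2
  | .inr _ => fun _ s => (1 + spin s * u) / 2

theorem prod_const_messages (α : IsingFactor 4) (i : Fin 4) (x y : ℝ) :
    (∏ β with β ≠ α, ∏ l with isingVar β l = i, Sum.elim (fun _ => x) (fun _ => y) β)
      = x ^ (∑ j : Fin 4 with .inl j ≠ α,
            (Finset.univ.filter fun l => isingVar (.inl j) l = i).card)
        * y ^ (∑ e : {e : Fin 4 × Fin 4 // e.1 < e.2} with .inr e ≠ α,
            (Finset.univ.filter fun l => isingVar (.inr e) l = i).card) := by
  simp only [Finset.prod_const]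
  rw [Finset.prod_filter, Fintype.prod_sum_type, Finset.sum_filter, Finset.sum_filter,
    ← Finset.prod_pow_eq_pow_sum, ← Finset.prod_pow_eq_pow_sum]
  congr 1 <;> refine Finset.prod_congr rfl fun j _ => ?_ <;> split_ifs <;> simp

theorem card_other_messages (e : {e : Fin 4 × Fin 4 // e.1 < e.2}) (k : Fin 2) :
    (∑ j : Fin 4 with (.inl j : IsingFactor 4) ≠ .inr e,
      (Finset.univ.filter fun l => isingVar (.inl j) l = isingVar (.inr e) k).card) = 1 ∧
    (∑ e' : {e : Fin 4 × Fin 4 // e.1 < e.2} with (.inr e' : IsingFactor 4) ≠ .inr e,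
      (Finset.univ.filter fun l => isingVar (.inr e') l = isingVar (.inr e) k).card) = 2 := by
  revert e k; decide

/-- Each node of a pair receives one message from its own factor and two from the other pairs that
contain it. -/
theorem nodeToFactor_of_const {m : (isingModel 4).Messages} {f g : Bool → ℝ}
    (hm : ∀ β l s, m β l s = Sum.elim (fun _ => f s) (fun _ => g s) β)
    (e : {e : Fin 4 × Fin 4 // e.1 < e.2}) (k : Fin 2) (s : Bool) :
    (isingModel 4).nodeToFactor m (.inr e) k s
      = GraphicalModel.normalized (fun s => f s * g s ^ 2) s := by
  refine congrFun (congrArg GraphicalModel.normalized (funext fun s => ?_)) s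
  simp only [hm]
  refine (prod_const_messages (.inr e) (isingVar (.inr e) k) (f s) (g s)).trans ?_
  rw [(card_other_messages e k).1, (card_other_messages e k).2, pow_one]

theorem biasedMessages_apply (u : ℝ) (β : IsingFactor 4) (l) (s : Bool) :
    biasedMessages u β l s = Sum.elim (fun _ => 1 / 2) (fun _ => (1 + spin s * u) / 2) β := by
  rcases β with i | e <;> rfl

/-- The hypothesis on the coupling `θ` of a pair, `e^{-θ} (1 + t) = e^θ (1 - t)`, says that
`t = tanh θ`. Belief propagation without fields and with such couplings acts on the
bias of symmetric messages by a one-dimensional map. -/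
theorem bpStep_biasedMessages {θ : (isingModel 4).Params} {t : ℝ}
    (h0 : ∀ i, θ (.inl i) (0 : Fin 1) = 0)
    (ht : ∀ e, Real.exp (-θ (.inr e) (0 : Fin 1)) * (1 + t)
      = Real.exp (θ (.inr e) (0 : Fin 1)) * (1 - t)) (a u : ℝ) :
    (isingModel 4).bpStep θ a (biasedMessages u)
      = biasedMessages (a * u + (1 - a) * (2 * t * u / (1 + u ^ 2))) := by
  funext α
  rcases α with i | e
  · funext k s
    have hk : k = (0 : Fin 1) := Subsingleton.elim (α := Fin 1) _ _
    subst hk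
    change a * (1 / 2) + (1 - a) * (isingModel 4).factorToNode θ _ (.inl i) (0 : Fin 1) s = 1 / 2
    rw [factorToNode_inl, h0]
    norm_num
    ring
  · funext k s
    change a * ((1 + spin s * u) / 2) + (1 - a) * (isingModel 4).factorToNode θ _ (.inr e) k s
      = (1 + spin s * _) / 2
    rw [factorToNode_inr, nodeToFactor_of_const (biasedMessages_apply u),
      nodeToFactor_of_const (biasedMessages_apply u), normalized_bool, normalized_bool,
      normalized_bool]
    have hE := Real.exp_pos (θ (.inr e) (0 : Fin 1))
    have hE' := Real.exp_pos (-θ (.inr e) (0 : Fin 1))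
    have hte := ht e
    have hu : 0 < 1 + u ^ 2 := by positivity
    have hmsg : ∀ s, (1 / 2 * ((1 + spin s * u) / 2) ^ 2 : ℝ)
        / (1 / 2 * ((1 + spin true * u) / 2) ^ 2 + 1 / 2 * ((1 + spin false * u) / 2) ^ 2)
        = (1 + spin s * (2 * u / (1 + u ^ 2))) / 2 := by
      intro s
      rw [div_eq_iff (by simp; nlinarith [sq_nonneg u])]
      cases s <;> simp <;> field_simp <;> ring
    rw [hmsg, hmsg]
    -- `w` is the bias of the node-to-factor messages.
    set w := 2 * u / (1 + u ^ 2) with hw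
    have hw' : 2 * t * u / (1 + u ^ 2) = t * w := by rw [hw]; ring
    have hmain : ∀ s, (Real.exp (θ (.inr e) (0 : Fin 1) * spin s) * ((1 + spin true * w) / 2)
        + Real.exp (-(θ (.inr e) (0 : Fin 1) * spin s)) * ((1 + spin false * w) / 2))
        = (Real.exp (θ (.inr e) (0 : Fin 1)) + Real.exp (-θ (.inr e) (0 : Fin 1)))
          * ((1 + spin s * (t * w)) / 2) := by
      intro s
      cases s
      · simp; linear_combination (w / 2) * hte
      · simp; linear_combination (-w / 2) * hte
    simp only [hmain]
    rw [← mul_add, mul_div_mul_left _ _ (by positivity), hw']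
    simp
    ring

theorem nodeToFactor_pos {n : ℕ} {m : (isingModel n).Messages}
    (hm : m ∈ (isingModel n).messageSpace) (α : IsingFactor n) (k) (s : Bool) :
    0 < (isingModel n).nodeToFactor m α k s := by
  have h : ∀ s, 0 < ∏ β with β ≠ α, ∏ l with isingVar β l = isingVar α k, m β l s := fun s =>
    Finset.prod_pos fun β _ => Finset.prod_pos fun l _ => (hm β l).1 s
  rw [GraphicalModel.nodeToFactor, normalized_bool]
  exact div_pos (h s) (add_pos (h true) (h false))

theorem nodeToFactor_add {n : ℕ} {m : (isingModel n).Messages}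
    (hm : m ∈ (isingModel n).messageSpace) (α : IsingFactor n) (k) :
    (isingModel n).nodeToFactor m α k true + (isingModel n).nodeToFactor m α k false = 1 := by
  have h : ∀ s, 0 < ∏ β with β ≠ α, ∏ l with isingVar β l = isingVar α k, m β l s := fun s =>
    Finset.prod_pos fun β _ => Finset.prod_pos fun l _ => (hm β l).1 s
  rw [GraphicalModel.nodeToFactor, normalized_bool, normalized_bool, ← add_div]
  exact div_self (add_pos (h true) (h false)).ne'

/-- The pair beliefs, up to their normalization constant `Z`. -/
theorem beliefs_inr {n : ℕ} {m : (isingModel n).Messages}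
    (hm : m ∈ (isingModel n).messageSpace) (θ : (isingModel n).Params)
    (e : {e : Fin n × Fin n // e.1 < e.2}) : ∃ Z : ℝ, 0 < Z ∧ ∀ s t : Bool,
      Z * ((isingModel n).beliefs θ m).2 (.inr e) ![s, t]
        = Real.exp (θ (.inr e) (0 : Fin 1) * (spin s * spin t))
          * ((isingModel n).nodeToFactor m (.inr e) (0 : Fin 2) s
            * (isingModel n).nodeToFactor m (.inr e) (1 : Fin 2) t) := by
  have hpos : ∀ y : Fin 2 → Bool, 0 < (isingModel n).potential θ (.inr e) y *
      ∏ k : Fin 2, (isingModel n).nodeToFactor m (.inr e) k (y k) := fun y =>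
    mul_pos (Real.exp_pos _) (Finset.prod_pos fun k _ => nodeToFactor_pos hm _ _ _)
  have hZ := Finset.sum_pos (fun y _ => hpos y) Finset.univ_nonempty
  refine ⟨_, hZ, fun s t => ?_⟩
  refine (mul_div_cancel₀ _ hZ.ne').trans ?_
  beta_reduce
  rw [potential_inr, Fin.prod_univ_two]
  rfl

theorem beliefs_inl {n : ℕ} {m : (isingModel n).Messages}
    (hm : m ∈ (isingModel n).messageSpace) (θ : (isingModel n).Params) (i : Fin n) :
    ∃ Z : ℝ, 0 < Z ∧ ∀ s : Bool, Z * ((isingModel n).beliefs θ m).2 (.inl i) ![s]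
      = Real.exp (θ (.inl i) (0 : Fin 1) * spin s)
        * (isingModel n).nodeToFactor m (.inl i) (0 : Fin 1) s := by
  have hpos : ∀ y : Fin 1 → Bool, 0 < (isingModel n).potential θ (.inl i) y *
      ∏ k : Fin 1, (isingModel n).nodeToFactor m (.inl i) k (y k) := fun y =>
    mul_pos (Real.exp_pos _) (Finset.prod_pos fun k _ => nodeToFactor_pos hm _ _ _)
  have hZ := Finset.sum_pos (fun y _ => hpos y) Finset.univ_nonempty
  refine ⟨_, hZ, fun s => ?_⟩
  refine (mul_div_cancel₀ _ hZ.ne').trans ?_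
  beta_reduce
  rw [potential_inl, Fin.prod_univ_one]
  rfl

/-- The marginals of the four-node model are symmetric under a global spin flip, so the parameters
and the messages of any fixed point with these beliefs are determined: there are no fields, the
coupling is `tanh⁻¹ (4ρ - 1)` on each pair, and all messages are uniform. -/
theorem fixedPoint_of_beliefs_eq {J a : ℝ} (ha : a < 1) {θ : (isingModel 4).Params}
    {m : (isingModel 4).Messages} (hm : m ∈ (isingModel 4).messageSpace)
    (hfix : (isingModel 4).bpStep θ a m = m)
    (hb : (isingModel 4).beliefs θ m = fourNodeMarginals J) :
    (∀ i, θ (.inl i) (0 : Fin 1) = 0) ∧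
    (∀ e, Real.exp (-θ (.inr e) (0 : Fin 1)) * (1 + (4 * rho J - 1))
      = Real.exp (θ (.inr e) (0 : Fin 1)) * (1 - (4 * rho J - 1))) ∧
    m = biasedMessages 0 := by
  -- Since `a < 1`, fixed points of the damped and of the undamped algorithm agree.
  have hm_eq : ∀ α k s, m α k s
      = (isingModel 4).factorToNode θ ((isingModel 4).nodeToFactor m) α k s := by
    intro α k s
    have h : a * m α k s + (1 - a) *
        (isingModel 4).factorToNode θ ((isingModel 4).nodeToFactor m) α k s = m α k s :=
      congrFun (congrFun (congrFun hfix α) k) s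
    refine mul_left_cancel₀ (sub_pos.2 ha).ne' ?_
    linarith
  have hpair : ∀ e : {e : Fin 4 × Fin 4 // e.1 < e.2},
      (∀ (k : Fin 2) s, (isingModel 4).nodeToFactor m (.inr e) k s = 1 / 2) ∧
      Real.exp (-θ (.inr e) (0 : Fin 1)) * (1 + (4 * rho J - 1))
        = Real.exp (θ (.inr e) (0 : Fin 1)) * (1 - (4 * rho J - 1)) := by
    intro e
    obtain ⟨Z, hZ, h⟩ := beliefs_inr hm θ e
    simp only [hb, fourNodeMarginals_pair] at h
    have hTT := h true true
    have hTF := h true false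
    have hFT := h false true
    have hFF := h false false
    simp only [spin_true, spin_false, mul_one, mul_neg, neg_neg, if_true,
      reduceCtorEq, if_false] at hTT hTF hFT hFF
    have hA := Real.exp_pos (θ (.inr e) (0 : Fin 1))
    have hB := Real.exp_pos (-θ (.inr e) (0 : Fin 1))
    have p0 := nodeToFactor_pos hm (.inr e) (0 : Fin 2) true
    have q0 := nodeToFactor_pos hm (.inr e) (0 : Fin 2) false
    have r0 := nodeToFactor_pos hm (.inr e) (1 : Fin 2) true
    have s0 := nodeToFactor_pos hm (.inr e) (1 : Fin 2) false
    have hpq := nodeToFactor_add hm (.inr e) (0 : Fin 2)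
    have hrs := nodeToFactor_add hm (.inr e) (1 : Fin 2)
    -- `b(+,+) = b(-,-)` and `b(+,-) = b(-,+)` force the two incoming messages to be uniform.
    have hk : ∀ (k : Fin 2) s, (isingModel 4).nodeToFactor m (.inr e) k s = 1 / 2 := by
      generalize hp : (isingModel 4).nodeToFactor m (.inr e) (0 : Fin 2) true = p at *
      generalize hq : (isingModel 4).nodeToFactor m (.inr e) (0 : Fin 2) false = q at *
      generalize hr : (isingModel 4).nodeToFactor m (.inr e) (1 : Fin 2) true = r at *
      generalize hs : (isingModel 4).nodeToFactor m (.inr e) (1 : Fin 2) false = s at *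
      have h1 : p * r = q * s := mul_left_cancel₀ hA.ne' (hTT.symm.trans hFF)
      have h2 : p * s = q * r := mul_left_cancel₀ hB.ne' (hTF.symm.trans hFT)
      have hp2 : p = 1 / 2 := by
        linear_combination (1 / 2) * h1 + (1 / 2) * h2 - (p - q) / 2 * hrs + (1 / 2) * hpq
      have hr2 : r = 1 / 2 := by
        have hq2 : q = 1 / 2 := by linarith
        rw [hp2, hq2] at h1
        linarith
      intro k t
      fin_cases k <;> cases t
      · exact hq.trans (by linarith)
      · exact hp.trans (by linarith)
      · exact hs.trans (by linarith)
      · exact hr.trans (by linarith)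
    refine ⟨hk, mul_left_cancel₀ hZ.ne' ?_⟩
    rw [hk, hk] at hTT hTF
    linear_combination 4 * Real.exp (-θ (.inr e) (0 : Fin 1)) * hTT
      - 4 * Real.exp (θ (.inr e) (0 : Fin 1)) * hTF
  have hmpair : ∀ (e : {e : Fin 4 × Fin 4 // e.1 < e.2}) (k : Fin 2) s,
      m (.inr e) k s = 1 / 2 := by
    intro e k s
    rw [hm_eq, factorToNode_inr, normalized_bool, (hpair e).1, (hpair e).1]
    have hA := Real.exp_pos (θ (.inr e) (0 : Fin 1))
    have hB := Real.exp_pos (-θ (.inr e) (0 : Fin 1))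
    cases s <;> simp <;> field_simp <;> ring
  have hfield : ∀ i, θ (.inl i) (0 : Fin 1) = 0 := by
    intro i
    -- The node passes to its own factor only messages from pairs, which are uniform.
    have hsymm : (isingModel 4).nodeToFactor m (.inl i) (0 : Fin 1) true
        = (isingModel 4).nodeToFactor m (.inl i) (0 : Fin 1) false := by
      rw [GraphicalModel.nodeToFactor, normalized_bool, normalized_bool]
      congr 1
      refine Finset.prod_congr rfl fun β hβ => Finset.prod_congr rfl fun l hl => ?_
      rcases β with j | e
      · have hl0 : l = (0 : Fin 1) := Subsingleton.elim (α := Fin 1) _ _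
        subst hl0
        have hj : j = i := (Finset.mem_filter.1 hl).2
        exact absurd (congrArg Sum.inl hj) (Finset.mem_filter.1 hβ).2
      · rw [hmpair, hmpair]
    obtain ⟨Z, hZ, h⟩ := beliefs_inl hm θ i
    simp only [hb, fourNodeMarginals_single] at h
    have h' := (h true).symm.trans (h false)
    rw [hsymm] at h'
    have h'' := Real.exp_injective (mul_right_cancel₀ (nodeToFactor_pos hm _ _ _).ne' h')
    simp only [spin_true, spin_false] at h''
    linarith
  refine ⟨hfield, fun e => (hpair e).2, ?_⟩
  funext α k s
  rcases α with i | e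
  · have hk : k = (0 : Fin 1) := Subsingleton.elim (α := Fin 1) _ _
    subst hk
    rw [hm_eq, factorToNode_inl, hfield]
    norm_num [biasedMessages]
  · rw [hmpair]
    norm_num [biasedMessages]

/-- For `t > 1/2` the bias zero is a repelling fixed point of the one-dimensional map: below some
`δ` the bias grows at least geometrically. -/
theorem exists_not_eventually_bias_lt {t a : ℝ} (ht : 1 / 2 < t) (ha0 : 0 ≤ a) (ha : a < 1) :
    ∃ δ > 0, ∀ u₀ > 0, ¬ ∀ᶠ k in atTop,
      (fun u : ℝ => a * u + (1 - a) * (2 * t * u / (1 + u ^ 2)))^[k] u₀ < δ := by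
  set g : ℝ → ℝ := fun u => a * u + (1 - a) * (2 * t * u / (1 + u ^ 2)) with hg
  set δ := min 1 ((2 * t - 1) / 2) with hδ
  have hδ0 : 0 < δ := lt_min one_pos (by linarith)
  have hδ2 : 1 + δ ^ 2 < 2 * t := by
    have h1 : δ ≤ 1 := min_le_left _ _
    have h2 : δ ≤ (2 * t - 1) / 2 := min_le_right _ _
    nlinarith
  set r := 2 * t / (1 + δ ^ 2) with hr
  have hr1 : 1 < r := by rw [hr, lt_div_iff₀ (by positivity)]; linarith
  set c := a + (1 - a) * r with hc
  have hc1 : 1 < c := by nlinarith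
  have hpos : ∀ u, 0 < u → 0 < g u := by
    intro u hu
    have : 0 < (1 - a) * (2 * t * u / (1 + u ^ 2)) :=
      mul_pos (by linarith) (div_pos (mul_pos (by linarith) hu) (by positivity))
    have : 0 ≤ a * u := by positivity
    simp only [hg]; linarith
  have hgrow : ∀ u, 0 < u → u < δ → c * u ≤ g u := by
    intro u hu huδ
    have h : r * u ≤ 2 * t * u / (1 + u ^ 2) := by
      rw [hr, div_mul_eq_mul_div]
      exact div_le_div_of_nonneg_left (mul_pos (by linarith) hu).le (by positivity) (by gcongr)
    have := mul_le_mul_of_nonneg_left h (sub_pos.2 ha).le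
    simp only [hg, hc]; linarith
  refine ⟨δ, hδ0, fun u₀ hu₀ hev => ?_⟩
  have hseq : ∀ k, 0 < g^[k] u₀ := by
    intro k
    induction k with
    | zero => exact hu₀
    | succ k ih => rw [Function.iterate_succ_apply']; exact hpos _ ih
  obtain ⟨N, hN⟩ := eventually_atTop.1 hev
  have hgeo : ∀ k, c ^ k * g^[N] u₀ ≤ g^[N + k] u₀ := by
    intro k
    induction k with
    | zero => simp
    | succ k ih =>
      rw [← add_assoc, Function.iterate_succ_apply' g (N + k), pow_succ']
      have := hgrow _ (hseq (N + k)) (hN (N + k) (by omega))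
      nlinarith
  have htend : Tendsto (fun k : ℕ => c ^ k * g^[N] u₀) atTop atTop :=
    (tendsto_pow_atTop_atTop_of_one_lt hc1).atTop_mul_const (hseq N)
  obtain ⟨k, hk⟩ := (htend.eventually_ge_atTop δ).exists
  exact absurd (hN (N + k) (by omega)) (not_lt.2 (hk.trans (hgeo k)))

theorem biasedMessages_mem_messageSpace {u : ℝ} (h1 : -1 < u) (h2 : u < 1) :
    biasedMessages u ∈ (isingModel 4).messageSpace := by
  intro α k
  rcases α with i | e
  · constructor
    · intro s; norm_num [biasedMessages]
    · norm_num [biasedMessages]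
  · constructor
    · intro s; cases s <;> simp [biasedMessages] <;> linarith
    · simp [biasedMessages]; ring

theorem continuous_biasedMessages : Continuous biasedMessages := by
  refine continuous_pi fun α => continuous_pi fun k => continuous_pi fun s => ?_
  rcases α with i | e <;> simp only [biasedMessages] <;> fun_prop

theorem isUnbelievable_fourNodeMarginals {J : ℝ} (hJ : 3 / 8 < rho J) :
    (isingModel 4).IsUnbelievable (fourNodeMarginals J) := by
  intro θ a ha0 ha m hm hfix hb
  obtain ⟨h0, ht, rfl⟩ := fixedPoint_of_beliefs_eq ha hm hfix hb
  obtain ⟨δ, hδ, hg⟩ := exists_not_eventually_bias_lt (t := 4 * rho J - 1) (by linarith) ha0 ha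
  have hiter : ∀ (k : ℕ) (u : ℝ), ((isingModel 4).bpStep θ a)^[k] (biasedMessages u)
      = biasedMessages ((fun u : ℝ => a * u
        + (1 - a) * (2 * (4 * rho J - 1) * u / (1 + u ^ 2)))^[k] u) := fun k u =>
    (Function.Semiconj.iterate_right (fun u => (bpStep_biasedMessages h0 ht a u).symm) k u).symm
  -- One message probability suffices to observe the bias.
  set obs : (isingModel 4).Messages → ℝ :=
    fun m => m (.inr ⟨(0, 1), by decide⟩) (0 : Fin 2) true with hobs
  have hobs_bias : ∀ u, obs (biasedMessages u) = (1 + u) / 2 := fun u => by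
    simp [hobs, biasedMessages]
  have hobs_cont : Continuous obs := by fun_prop
  -- Every neighbourhood of the fixed point contains messages with a small positive bias.
  have hstart : ∀ W ∈ 𝓝 (biasedMessages 0), ∃ u > 0,
      biasedMessages u ∈ W ∩ (isingModel 4).messageSpace := by
    intro W hW
    have hev : ∀ᶠ u in 𝓝[>] (0 : ℝ), biasedMessages u ∈ W :=
      (continuous_biasedMessages.tendsto 0).mono_left nhdsWithin_le_nhds hW
    obtain ⟨u, huW, hu0, hu1⟩ := (hev.and (Ioo_mem_nhdsGT one_pos)).exists
    exact ⟨u, hu0, huW, biasedMessages_mem_messageSpace (by linarith) hu1⟩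
  have hU : {m | obs m < (1 + δ) / 2} ∈ 𝓝 (biasedMessages 0) :=
    (isOpen_lt hobs_cont continuous_const).mem_nhds (by
      simp only [Set.mem_ofPred_eq, hobs_bias]; linarith)
  constructor
  · intro hstable
    obtain ⟨W, hW, hrun⟩ := hstable _ hU
    obtain ⟨u, hu, hmem⟩ := hstart W hW
    refine hg u hu (Eventually.of_forall fun k => ?_)
    have h := hrun _ hmem k
    rw [hiter, Set.mem_ofPred_eq, hobs_bias] at h
    linarith
  · rintro ⟨W, hW, hrun⟩
    obtain ⟨u, hu, hmem⟩ := hstart W hW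
    refine hg u hu ((hrun _ hmem).eventually hU |>.mono fun k h => ?_)
    rw [hiter, hobs_bias] at h
    linarith

theorem theorem1 :
    -- unbelievable marginals of a distribution exist
    (∃ θ : (isingModel 4).Params,
      (isingModel 4).IsUnbelievable ((isingModel 4).marginals θ)) ∧
    -- the true marginals of the four-node model with coupling `J`
    (∀ J : ℝ,
      (∀ i s, (fourNodeMarginals J).1 i s = 1 / 2) ∧
      (∀ (e : {e : Fin 4 × Fin 4 // e.1 < e.2}) (s t : Bool),
        (fourNodeMarginals J).2 (.inr e) ![s, t] = if s = t then rho J else 1 / 2 - rho J) ∧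
      isingPseudo 4 (isingCoords 4 (fourNodeMarginals J)) = fourNodeMarginals J) ∧
    -- `ρ > 3/8` means `J > 0.316` (the exact threshold, rounded to three decimals)
    (∃ Jc : ℝ, 0.3155 < Jc ∧ Jc < 0.316 ∧ ∀ J : ℝ, 3 / 8 < rho J ↔ Jc < J) ∧
    -- for all these couplings
    (∀ J : ℝ, 3 / 8 < rho J →
      -- the Bethe Hessian has a negative eigenvalue at the true marginals,
      (∀ θ : (isingModel 4).Params,
        ContDiffAt ℝ 2 (isingBethe 4 θ) (isingCoords 4 (fourNodeMarginals J)) ∧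
        ∃ μ : ℝ, μ < 0 ∧ Module.End.HasEigenvalue (Matrix.toLin'
          (hessianMatrix (isingBethe 4 θ) (isingCoords 4 (fourNodeMarginals J)))) μ) ∧
      -- they are not a local minimum of the Bethe free energy, whatever the parameters,
      (∀ θ : (isingModel 4).Params,
        ¬ IsLocalMinOn ((isingModel 4).betheFreeEnergy θ) (isingModel 4).pseudomarginals
          (fourNodeMarginals J)) ∧
      -- and they are unbelievable
      (isingModel 4).IsUnbelievable (fourNodeMarginals J)) := by
  refine ⟨?_, fun J => ⟨fourNodeMarginals_node J, fourNodeMarginals_pair J,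
    isingPseudo_isingCoords_fourNodeMarginals J⟩, exists_rho_threshold, fun J hJ =>
    ⟨fun θ => ?_, not_isLocalMinOn_betheFreeEnergy hJ, isUnbelievable_fourNodeMarginals hJ⟩⟩
  · obtain ⟨Jc, -, hJc, h⟩ := exists_rho_threshold
    exact ⟨isingCoupling 4 1,
      isUnbelievable_fourNodeMarginals ((h 1).2 (hJc.trans (by norm_num)))⟩
  · have hdiff := contDiffAt_isingBethe_fourNodeMarginals J θ
    exact ⟨hdiff, exists_neg_eigenvalue_hessianMatrix hdiff
      ((deriv_deriv_isingBethe_line J θ).trans_lt (curvature_neg hJ))⟩
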